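/- Let $d,T\ge 1$ be integers and let $\sigma:\mathbb R\to\mathbb R$ be continuous, bounded, injective, not a polynomial, and such that $\sigma(0)=0$; for a vector $z$ let $\sigma(z)$ denote the vector obtained by applying $\sigma$ to each coordinate. Given $N\in\mathbb N$, matrices $A_1,A_2^1,\dots,A_2^d\in\mathbb R^{N\times N}$ and vectors $\xi_1,\xi_2^1,\dots,\xi_2^d\in\mathbb R^N$, the randomised signature of $x=(x_1,\dots,x_T)\in(\mathbb R^d)^T$ is defined by $\mathrm{RS}_0(x)=0\in\mathbb R^N$ and $$\mathrm{RS}_t(x)=\mathrm{RS}_{t-1}(x)+\sigma\big(A_1\mathrm{RS}_{t-1}(x)+\xi_1\big)+\sum_{i=1}^d\sigma\big(A_2^i\,\mathrm{RS}_{t-1}(x)+\xi_2^i\big)\,x_t^i,\qquad t=1,\dots,T,$$ and $\Delta\mathrm{RS}_T(x)=\mathrm{RS}_T(x)-\mathrm{RS}_{T-1}(x)$. Sampling Scheme 1. Let $\mu_1$ be a probability distribution on $\mathbb R$ that is absolutely continuous with respect to Lebesgue measure and has full support. For $M\in\mathbb N$ put $N=M+Td$ and $$A_1=\begin{bmatrix}0_{M\times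 M}&A\\0_{Td\times M}&\begin{bmatrix}0_{d\times(T-1)d}&0_{d\times d}\\U&0_{(T-1)d\times d}\end{bmatrix}\end{bmatrix},\quad \xi_1=\begin{bmatrix}\xi\\0_{Td\times1}\end{bmatrix},\quad A_2^i=0_{N\times N},\quad \xi_2^i=\begin{bmatrix}0_{M\times1}\\a_ie_i\end{bmatrix},$$ where $e_i$ is the $i$-th canonical basis vector of $\mathbb R^{Td}$, $A$ is a random $M\times Td$ matrix, $\xi$ is a random vector in $\mathbb R^M$, $U$ is an upper triangular random $(T-1)d\times(T-1)d$ matrix, $a_1,\dots,a_d$ are random variables, and all the entries of $A$, of $U$ on and above the diagonal, of $\xi$, and $a_1,\dots,a_d$ are i.i.d. with distribution $\mu_1$. Let $K\subseteq\mathbb R^d$ be compact and let $f:K^{T-1}\to\mathbb R$ be continuous. Then for every $\alpha\in(0,1)$ and every $\varepsilon>0$ there is an integer $M\ge1$ such that, whenever the weights are sampled according to Sampling Scheme 1 with this $M$, with probability greater than $\alpha$ there exists $\tilde w\in\mathbb R^M$ such that $w=(\tilde w,0)\in\mathbb R^{M+Td}$ satisfies $$\sup\big|f(x_1,\dots,x_{T-1})-\langle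 w,\Delta\mathrm{RS}_T(x)\rangle\big|<\varepsilon ,$$ where the supremum is taken over all $x=(x_1,\dots,x_T)$ with $x_1,\dots,x_{T-1}\in K$ and $x_T\in\mathbb R^d$ arbitrary. -/

import Mathlib

open MeasureTheory ProbabilityTheory Matrix

noncomputable section

namespace RandSig

/-- The randomised signature with coefficients `A₁, ξ₁, A₂, ξ₂` and activation `σ` (applied
coordinatewise) of the datastream `x`: `RS_0 = 0` and
`RS_{t+1} = RS_t + σ(A₁ RS_t + ξ₁) + ∑ i, σ(A₂ⁱ RS_t + ξ₂ⁱ) x_{t+1}ⁱ`.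
The stream `x_1, …, x_T` is stored as `x 0, …, x (T - 1)`; the times of `RS` are `0, …, T`.
The state space is `ℝ^ι`, where `ι` is any finite index set. -/
def RS {ι : Type*} [Fintype ι] {d T : ℕ} (σ : ℝ → ℝ)
    (A₁ : Matrix ι ι ℝ) (ξ₁ : ι → ℝ) (A₂ : Fin d → Matrix ι ι ℝ) (ξ₂ : Fin d → ι → ℝ)
    (x : Fin T → EuclideanSpace ℝ (Fin d)) (t : Fin (T + 1)) : ι → ℝ :=
  Fin.induction (motive := fun _ => ι → ℝ) 0
    (fun s r => r + (fun k => σ ((A₁ *ᵥ r + ξ₁) k))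
      + ∑ i : Fin d, x s i • (fun k => σ ((A₂ i *ᵥ r + ξ₂ i) k))) t

/-- The increment `RS_{t+1} - RS_t`. With `t = T - 1` this is the terminal increment `ΔRS_T`. -/
def deltaRS {ι : Type*} [Fintype ι] {d T : ℕ} (σ : ℝ → ℝ)
    (A₁ : Matrix ι ι ℝ) (ξ₁ : ι → ℝ) (A₂ : Fin d → Matrix ι ι ℝ) (ξ₂ : Fin d → ι → ℝ)
    (x : Fin T → EuclideanSpace ℝ (Fin d)) (t : Fin T) : ι → ℝ :=
  RS σ A₁ ξ₁ A₂ ξ₂ x t.succ - RS σ A₁ ξ₁ A₂ ξ₂ x t.castSucc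

/-- The index set of `ℝ^{Td} = (ℝ^d)^T`: the pair `(k, i)` stands for coordinate number `k d + i`
(counted from `0`), so the usual order of the coordinates is the lexicographic order of pairs. -/
abbrev Block (T d : ℕ) : Type := Fin T × Fin d

/-- The index set of `ℝ^N` with `N = M + T d`. -/
abbrev State (M T d : ℕ) : Type := Fin M ⊕ Block T d

/-- The matrix `[0 0; U 0]` of size `Td × Td`, with the `(T-1)d × (T-1)d` matrix `U` in the lower
left corner, a zero block row of height `d` on top and a zero block column of width `d` on the
right. -/
def shiftMatrix {T d : ℕ} (U : Matrix (Block (T - 1) d) (Block (T - 1) d) ℝ) :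
    Matrix (Block T d) (Block T d) ℝ :=
  Matrix.of fun p q =>
    if h : 1 ≤ p.1.val ∧ q.1.val < T - 1 then
      U (⟨p.1.val - 1, by have := p.1.isLt; omega⟩, p.2) (⟨q.1.val, h.2⟩, q.2)
    else 0

/-- The matrix `A₁ = [0 A; 0 [0 0; U 0]]`. -/
def schemeA₁ {M T d : ℕ} (A : Matrix (Fin M) (Block T d) ℝ)
    (U : Matrix (Block (T - 1) d) (Block (T - 1) d) ℝ) :
    Matrix (State M T d) (State M T d) ℝ :=
  Matrix.fromBlocks 0 A 0 (shiftMatrix U)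

/-- The bias `ξ₁ = [ξ; 0]`. -/
def schemeξ₁ {M : ℕ} (T d : ℕ) (ξ : Fin M → ℝ) : State M T d → ℝ :=
  Sum.elim ξ 0

/-- The matrices `A₂ⁱ = 0`. -/
def schemeA₂ (M T d : ℕ) : Fin d → Matrix (State M T d) (State M T d) ℝ :=
  fun _ => 0

/-- The biases `ξ₂ⁱ = [0; aᵢ eᵢ]`, where `eᵢ` is the `i`-th canonical basis vector of `ℝ^{Td}`
(`i = 1, …, d`), that is, the coordinate `i` of the first block. -/
def schemeξ₂ (M T : ℕ) {d : ℕ} (a : Fin d → ℝ) : Fin d → State M T d → ℝ :=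
  fun i => Sum.elim 0 (fun p => if p.1.val = 0 ∧ p.2 = i then a i else 0)

/-- The labels of the random entries: the entries of `A`, the entries of `U` on and above the
diagonal, the entries of `ξ`, and `a₁, …, a_d`. -/
abbrev EntryIndex (M T d : ℕ) : Type :=
  (Fin M × Block T d) ⊕
    {pq : Block (T - 1) d × Block (T - 1) d // toLex pq.1 ≤ toLex pq.2} ⊕ Fin M ⊕ Fin d

/-- The family of all random entries. -/
def entries {Ω : Type*} {M T d : ℕ} (A : Ω → Matrix (Fin M) (Block T d) ℝ)
    (U : Ω → Matrix (Block (T - 1) d) (Block (T - 1) d) ℝ) (ξ : Ω → Fin M → ℝ)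
    (a : Ω → Fin d → ℝ) : EntryIndex M T d → Ω → ℝ :=
  Sum.elim (fun jp ω => A ω jp.1 jp.2)
    (Sum.elim (fun pq ω => U ω pq.1.1 pq.1.2)
      (Sum.elim (fun j ω => ξ ω j) (fun i ω => a ω i)))

/-- The first sampling scheme: `U` is upper triangular, and all the entries of `A`, the entries of
`U` on and above the diagonal, the entries of `ξ` and the variables `a₁, …, a_d` are independent
random variables with the common distribution `μ₁`. -/
structure IsSamplingScheme {Ω : Type*} [MeasurableSpace Ω] (P : Measure Ω) (μ₁ : Measure ℝ)
    {M T d : ℕ} (A : Ω → Matrix (Fin M) (Block T d) ℝ)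
    (U : Ω → Matrix (Block (T - 1) d) (Block (T - 1) d) ℝ) (ξ : Ω → Fin M → ℝ)
    (a : Ω → Fin d → ℝ) : Prop where
  upper : ∀ ω p q, toLex q < toLex p → U ω p q = 0
  measurable : ∀ k, Measurable (entries A U ξ a k)
  law : ∀ k, P.map (entries A U ξ a k) = μ₁
  indep : iIndepFun (entries A U ξ a) P

/-- The standing assumption on the activation function. -/
structure IsActivation (σ : ℝ → ℝ) : Prop where
  continuous : Continuous σ
  bounded : ∃ C : ℝ, ∀ z, |σ z| ≤ C
  not_polynomial : ¬ ∃ p : Polynomial ℝ, ∀ z, σ z = p.eval z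
  injective : Function.Injective σ
  map_zero : σ 0 = 0

end RandSig

end

namespace RandSig

open Filter Topology

/-! The lower `Td` coordinates of the signature form a reservoir that ignores the other `M`, and the
upper part of the last increment is `σ(A r + ξ)`, where `r` is the reservoir state at time `T - 1`.
That state does not involve `x_T`, so the task is to approximate `f` by a network with random inner
weights evaluated at `r`.

The map from `(x_1, …, x_{T-1})` to `r` is injective once the diagonal of `U` and the `a_i` are
nonzero (`blockState_injective`): `U` is triangular and information moves down at most one block per
step, so the recursion can be run backwards. Over a compact set of streams, networks in an injective
feature are uniformly dense (`closure_span_neuronMap_eq_top`).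

An approximating network survives small perturbations of `(U, a)` and of its inner weights. A
compact set of parameters carrying probability above `α` therefore needs only finitely many open
sets of weights (`exists_finite_open_cover_readout`). Since `μ₁` has full support, i.i.d. rows miss
one of these sets with probability tending to `0` as `M` grows, and a union bound finishes the
proof. -/

/-! ### Univariate approximation by sigmoids. -/

/-- Superpositions of dilates and translates of a bounded sigmoid approximate continuous functions
uniformly on the unit interval. -/
theorem exists_sigmoid_sum_approx {τ : ℝ → ℝ} {C : ℝ} (hC : ∀ z, |τ z| ≤ C)
    (htop : Tendsto τ atTop (𝓝 1)) (hbot : Tendsto τ atBot (𝓝 0))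
    {g : ℝ → ℝ} (hg : Continuous g) {ε : ℝ} (hε : 0 < ε) :
    ∃ (n : ℕ) (c : ℕ → ℝ) (s : ℝ) (b : ℕ → ℝ), ∀ t ∈ Set.Icc (0 : ℝ) 1,
      |g t - (g 0 + ∑ k ∈ Finset.range n, c k * τ (s * t + b k))| < ε := by
  have hC0 : 0 ≤ C := (abs_nonneg _).trans (hC 0)
  -- The total error will be `δ` from rounding `t` down to a node, plus `δ` times `1 + 2 * (C + 1)`
  -- from the sigmoids.
  set δ : ℝ := ε / (2 * C + 5) with hδ
  have hδ0 : 0 < δ := by positivity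
  have huc : UniformContinuousOn g (Set.Icc 0 1) :=
    isCompact_Icc.uniformContinuousOn_of_continuous hg.continuousOn
  obtain ⟨r, hr0, hr⟩ := Metric.uniformContinuousOn_iff.1 huc δ hδ0
  obtain ⟨n, hn⟩ := exists_nat_gt (1 / r)
  have hn0 : (0 : ℝ) < n := lt_trans (by positivity) hn
  have hnr : 1 / (n : ℝ) < r := by
    rw [div_lt_iff₀ hr0] at hn
    rw [div_lt_iff₀ hn0]; linarith
  have h1n : (0 : ℝ) < 1 / n := by positivity
  obtain ⟨S₁, hS₁⟩ := eventually_atTop.1 (Metric.tendsto_nhds.1 htop (1 / n) h1n)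
  obtain ⟨S₂, hS₂⟩ := eventually_atBot.1 (Metric.tendsto_nhds.1 hbot (1 / n) h1n)
  set S : ℝ := max 1 (max S₁ (-S₂)) with hS
  have hSpos : 0 < S := lt_of_lt_of_le one_pos (le_max_left _ _)
  have hSS₁ : S₁ ≤ S := (le_max_left _ _).trans (le_max_right _ _)
  have hSS₂ : -S ≤ S₂ := by
    have : -S₂ ≤ S := (le_max_right _ _).trans (le_max_right _ _)
    linarith
  -- A staircase with the increments of `g` as step heights. The argument of `τ` is `S (n t - k)`,
  -- hence beyond `±S` for every node except `k = j` and `k = j + 1`, where `j = ⌊n t⌋`; at those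
  -- two only the crude bound is available.
  refine ⟨n, fun k => g ((k + 1 : ℕ) / n) - g (k / n), S * n, fun k => -(S * k), ?_⟩
  rintro t ⟨ht0, ht1⟩
  set j : ℕ := ⌊n * t⌋₊ with hj
  have hnt : 0 ≤ n * t := by positivity
  have hj1 : (j : ℝ) ≤ n * t := Nat.floor_le hnt
  have hj2 : n * t < j + 1 := Nat.lt_floor_add_one _
  have hjn : j ≤ n := by
    have : (j : ℝ) ≤ n := hj1.trans (by nlinarith)
    exact_mod_cast this
  have hΔ : ∀ k ∈ Finset.range n, |g ((k + 1 : ℕ) / n) - g (k / n)| ≤ δ := by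
    intro k hk
    have hk' : ((k + 1 : ℕ) : ℝ) ≤ n := by exact_mod_cast Finset.mem_range.1 hk
    have hkk : (k : ℝ) ≤ n := le_trans (by push_cast; linarith) hk'
    refine (hr _ ⟨by positivity, (div_le_one hn0).2 hk'⟩ _
      ⟨by positivity, (div_le_one hn0).2 hkk⟩ ?_).le
    rw [Real.dist_eq, ← sub_div]
    push_cast
    rw [add_sub_cancel_left, abs_of_pos h1n]
    exact hnr
  have hgt : |g t - g (j / n)| ≤ δ := by
    refine (hr _ ⟨ht0, ht1⟩ _ ⟨by positivity, (div_le_one hn0).2 (by exact_mod_cast hjn)⟩ ?_).le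
    rw [Real.dist_eq]
    have : t - j / n = (n * t - j) / n := by field_simp
    rw [this, abs_of_nonneg (div_nonneg (by linarith) hn0.le)]
    refine lt_of_le_of_lt ?_ hnr
    exact div_le_div_of_nonneg_right (by linarith) hn0.le
  have htel : g (j / n) = g 0 + ∑ k ∈ Finset.range n,
      (g ((k + 1 : ℕ) / n) - g (k / n)) * (if k < j then 1 else 0) := by
    simp only [mul_ite, mul_one, mul_zero]
    rw [← Finset.sum_filter]
    have : (Finset.range n).filter (· < j) = Finset.range j := by
      ext k; simp; omega
    rw [this, Finset.sum_range_sub (fun k : ℕ => g (k / n))]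
    simp
  have hterm : ∀ k ∈ Finset.range n, |(if k < j then (1 : ℝ) else 0) - τ (S * n * t + -(S * k))| ≤
      1 / n + ((if k = j then C + 1 else 0) + (if k = j + 1 then C + 1 else 0)) := by
    intro k _
    rcases lt_or_ge k j with h | h
    · have h' : (k : ℝ) + 1 ≤ j := by exact_mod_cast h
      have := hS₁ (S * n * t + -(S * k)) (hSS₁.trans (by nlinarith))
      rw [Real.dist_eq, abs_sub_comm] at this
      simp only [if_pos h]
      have h2 : k ≠ j := by omega
      have h3 : k ≠ j + 1 := by omega
      simp only [if_neg h2, if_neg h3]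
      linarith
    · rw [if_neg (by omega), zero_sub, abs_neg]
      by_cases h2 : k = j
      · have := hC (S * n * t + -(S * k))
        rw [if_pos h2, if_neg (by omega)]
        linarith
      by_cases h3 : k = j + 1
      · have := hC (S * n * t + -(S * k))
        rw [if_neg h2, if_pos h3]
        linarith
      · have h' : (j : ℝ) + 2 ≤ k := by exact_mod_cast (by omega : j + 2 ≤ k)
        have := hS₂ (S * n * t + -(S * k)) (le_trans (by nlinarith) hSS₂)
        rw [Real.dist_eq, sub_zero] at this
        rw [if_neg h2, if_neg h3]
        linarith
  have hsum : |∑ k ∈ Finset.range n, (g ((k + 1 : ℕ) / n) - g (k / n)) *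
      ((if k < j then (1 : ℝ) else 0) - τ (S * n * t + -(S * k)))| ≤ δ * (1 + 2 * (C + 1)) := by
    calc _ ≤ ∑ k ∈ Finset.range n, δ *
          (1 / n + ((if k = j then C + 1 else 0) + (if k = j + 1 then C + 1 else 0))) := by
          refine (Finset.abs_sum_le_sum_abs _ _).trans (Finset.sum_le_sum fun k hk => ?_)
          rw [abs_mul]
          exact mul_le_mul (hΔ k hk) (hterm k hk) (abs_nonneg _) hδ0.le
      _ ≤ _ := by
          rw [← Finset.mul_sum, Finset.sum_add_distrib, Finset.sum_add_distrib]
          refine mul_le_mul_of_nonneg_left ?_ hδ0.le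
          have e1 : ∑ _k ∈ Finset.range n, (1 / n : ℝ) = 1 := by
            rw [Finset.sum_const, Finset.card_range, nsmul_eq_mul]; field_simp
          have e2 : ∀ i : ℕ, ∑ k ∈ Finset.range n, (if k = i then C + 1 else 0) ≤ C + 1 := by
            intro i
            rw [Finset.sum_ite_eq']
            split_ifs <;> linarith
          have := e2 j
          have := e2 (j + 1)
          linarith
  have hdecomp : g t - (g 0 + ∑ k ∈ Finset.range n,
      (g ((k + 1 : ℕ) / n) - g (k / n)) * τ (S * n * t + -(S * k))) =
      (g t - g (j / n)) + ∑ k ∈ Finset.range n, (g ((k + 1 : ℕ) / n) - g (k / n)) *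
      ((if k < j then (1 : ℝ) else 0) - τ (S * n * t + -(S * k))) := by
    simp only [mul_sub, Finset.sum_sub_distrib]
    rw [htel]; ring
  rw [hdecomp]
  calc _ ≤ δ + δ * (1 + 2 * (C + 1)) := (abs_add_le _ _).trans (add_le_add hgt hsum)
    _ < δ * (2 * C + 5) := by nlinarith
    _ = ε := by rw [hδ]; field_simp

/-- An activation function has distinct limits at `±∞`. -/
theorem IsActivation.exists_limits {σ : ℝ → ℝ} (hσ : IsActivation σ) :
    ∃ l L : ℝ, l ≠ L ∧ Tendsto σ atBot (𝓝 l) ∧ Tendsto σ atTop (𝓝 L) := by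
  obtain ⟨C, hC⟩ := hσ.bounded
  have hA : BddAbove (Set.range σ) := ⟨C, by rintro _ ⟨z, rfl⟩; exact (abs_le.1 (hC z)).2⟩
  have hB : BddBelow (Set.range σ) := ⟨-C, by rintro _ ⟨z, rfl⟩; exact (abs_le.1 (hC z)).1⟩
  -- A continuous injection of `ℝ` is strictly monotone, and the values at `0` and `1` keep the two
  -- limits apart.
  rcases hσ.continuous.strictMono_of_inj hσ.injective with h | h
  · refine ⟨_, _, ?_, tendsto_atBot_ciInf h.monotone hB, tendsto_atTop_ciSup h.monotone hA⟩
    exact ((ciInf_le hB 0).trans_lt ((h one_pos).trans_le (le_ciSup hA 1))).ne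
  · refine ⟨_, _, ?_, tendsto_atBot_ciSup h.antitone hA, tendsto_atTop_ciInf h.antitone hB⟩
    exact ((ciInf_le hB 1).trans_lt ((h one_pos).trans_le (le_ciSup hA 0))).ne'

/-- The neuron with weights `v (some q)` and bias `v none` at the input `y`. -/
def neuron {Q : Type*} [Fintype Q] (σ : ℝ → ℝ) (v : Option Q → ℝ) (y : Q → ℝ) : ℝ :=
  σ (∑ q, v (some q) * y q + v none)

/-! ### Density of networks over an injective feature map. -/

section Density

variable {X Q : Type*} [TopologicalSpace X] [Fintype Q]

/-- The neuron `v` composed with a continuous feature map. -/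
def neuronMap {σ : ℝ → ℝ} (hσ : Continuous σ) (φ : C(X, Q → ℝ)) (v : Option Q → ℝ) : C(X, ℝ) where
  toFun x := neuron σ v (φ x)
  continuous_toFun := by unfold neuron; fun_prop

/-- The exponential of a linear functional of a continuous feature map. -/
noncomputable def expMap (φ : C(X, Q → ℝ)) (w : Q → ℝ) : C(X, ℝ) where
  toFun x := Real.exp (∑ q, w q * φ x q)
  continuous_toFun := by fun_prop

variable [CompactSpace X]

/-- The exponential depends on the feature only through a linear functional with values in some
`[-R, R]`. After rescaling this interval to `[0, 1]`, the univariate approximation applies, and each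
of its sigmoids is a neuron up to an affine change of its value. -/
theorem expMap_mem_closure_span_neuronMap {σ : ℝ → ℝ} (hσ : IsActivation σ) (φ : C(X, Q → ℝ))
    (w : Q → ℝ) :
    expMap φ w ∈
      (Submodule.span ℝ (Set.range (neuronMap hσ.continuous φ))).topologicalClosure := by
  obtain ⟨l, L, hlL, hl, hL⟩ := hσ.exists_limits
  obtain ⟨C, hC⟩ := hσ.bounded
  have hLl : L - l ≠ 0 := sub_ne_zero.2 hlL.symm
  set Sp := Submodule.span ℝ (Set.range (neuronMap hσ.continuous φ)) with hSp
  -- A neuron with zero weights and bias `1` is a nonzero constant.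
  have hconst : ∀ c : ℝ, ContinuousMap.const X c ∈ Sp := by
    intro c
    have h1 : σ 1 ≠ 0 := fun h => one_ne_zero (hσ.injective (h.trans hσ.map_zero.symm))
    have : ContinuousMap.const X c = (c / σ 1) •
        neuronMap hσ.continuous φ (fun o => o.elim 1 (fun _ => 0)) := by
      ext x
      simp [neuronMap, neuron, h1]
    rw [this]
    exact Sp.smul_mem _ (Submodule.subset_span ⟨_, rfl⟩)
  obtain ⟨R, hR0, hR⟩ : ∃ R : ℝ, 0 < R ∧ ∀ x, |∑ q, w q * φ x q| ≤ R := by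
    let F : C(X, ℝ) := ⟨fun x => ∑ q, w q * φ x q, by fun_prop⟩
    exact ⟨‖F‖ + 1, by positivity, fun x => (F.norm_coe_le_norm x).trans (by linarith)⟩
  rw [← SetLike.mem_coe, Submodule.topologicalClosure_coe, Metric.mem_closure_iff]
  intro ε hε
  obtain ⟨n, c, s, b, happ⟩ := exists_sigmoid_sum_approx (τ := fun z => (σ z - l) / (L - l))
    (C := (C + |l|) / |L - l|) (g := fun t => Real.exp (2 * R * t - R))
    (fun z => by
      rw [abs_div]
      exact div_le_div_of_nonneg_right ((abs_sub _ _).trans (add_le_add_left (hC z) _))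
        (abs_nonneg _))
    (by simpa [div_self hLl] using (hL.sub_const l).div_const (L - l))
    (by simpa using (hl.sub_const l).div_const (L - l)) (by fun_prop) (half_pos hε)
  -- The coefficients of `s * ((u + R) / (2 * R)) + b k`, expanded in the coordinates of the
  -- feature.
  let v : ℕ → Option Q → ℝ := fun k o =>
    o.elim (s * (1 / 2) + b k) (fun q => s * (w q / (2 * R)))
  refine ⟨ContinuousMap.const X (Real.exp (-R)) + ∑ k ∈ Finset.range n,
    (c k / (L - l)) • (neuronMap hσ.continuous φ (v k) - ContinuousMap.const X l), ?_, ?_⟩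
  · refine Sp.add_mem (hconst _) (Sp.sum_mem fun k _ => Sp.smul_mem _ (Sp.sub_mem ?_ (hconst _)))
    exact Submodule.subset_span ⟨_, rfl⟩
  · refine lt_of_le_of_lt ((ContinuousMap.dist_le (half_pos hε).le).2 fun x => ?_) (half_lt_self hε)
    set u := ∑ q, w q * φ x q with hu
    have hux := abs_le.1 (hR x)
    have ht := happ ((u + R) / (2 * R)) ⟨div_nonneg (by linarith) (by linarith), by
      rw [div_le_one (by linarith)]; linarith⟩
    have e1 : 2 * R * ((u + R) / (2 * R)) - R = u := by field_simp; ring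
    have e2 : ∀ k, ∑ q, v k (some q) * φ x q + v k none = s * ((u + R) / (2 * R)) + b k := by
      intro k
      have : ∑ q, v k (some q) * φ x q = s / (2 * R) * u := by
        rw [hu, Finset.mul_sum]
        refine Finset.sum_congr rfl fun q _ => ?_
        simp only [v, Option.elim]; ring
      rw [this]
      simp only [v, Option.elim]
      field_simp; ring
    rw [Real.dist_eq]
    refine le_trans (le_of_eq ?_) ht.le
    rw [e1]
    simp only [expMap, neuronMap, neuron, ContinuousMap.coe_mk, ContinuousMap.add_apply,
      ContinuousMap.const_apply, ContinuousMap.sum_apply, ContinuousMap.smul_apply,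
      ContinuousMap.sub_apply, smul_eq_mul, e2, mul_zero, zero_sub]
    congr 3
    exact Finset.sum_congr rfl fun k _ => by ring

/-- Single-layer networks composed with an injective feature map on a compact space are dense. -/
theorem closure_span_neuronMap_eq_top {σ : ℝ → ℝ} (hσ : IsActivation σ) (φ : C(X, Q → ℝ))
    (hφ : Function.Injective φ) :
    (Submodule.span ℝ (Set.range (neuronMap hσ.continuous φ))).topologicalClosure = ⊤ := by
  -- Exponentials are closed under products, so their linear span is already an algebra and
  -- Stone–Weierstrass applies to it.
  let S : Submonoid C(X, ℝ) :=
    { carrier := Set.range (expMap φ)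
      one_mem' := ⟨0, by ext x; simp [expMap]⟩
      mul_mem' := by
        rintro _ _ ⟨w, rfl⟩ ⟨w', rfl⟩
        refine ⟨w + w', ?_⟩
        ext x
        simp [expMap, add_mul, Finset.sum_add_distrib, Real.exp_add] }
  have hsep : (Algebra.adjoin ℝ (S : Set C(X, ℝ))).SeparatesPoints := by
    classical
    intro x y hxy
    obtain ⟨q, hq⟩ := Function.ne_iff.1 (hφ.ne hxy)
    refine ⟨_, ⟨expMap φ (Pi.single q 1), Algebra.subset_adjoin ⟨_, rfl⟩, rfl⟩, ?_⟩
    simpa [expMap, Pi.single_apply] using hq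
  have htop := ContinuousMap.subalgebra_topologicalClosure_eq_top_of_separatesPoints _ hsep
  have hle : Subalgebra.toSubmodule (Algebra.adjoin ℝ (S : Set C(X, ℝ))) ≤
      (Submodule.span ℝ (Set.range (neuronMap hσ.continuous φ))).topologicalClosure := by
    rw [Algebra.adjoin_eq_span, Submonoid.closure_eq, Submodule.span_le]
    rintro _ ⟨w, rfl⟩
    exact expMap_mem_closure_span_neuronMap hσ φ w
  rw [eq_top_iff]
  intro F _
  have hF : F ∈ (Algebra.adjoin ℝ (S : Set C(X, ℝ))).topologicalClosure := htop ▸ trivial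
  exact closure_minimal (SetLike.coe_subset_coe.2 hle) (Submodule.isClosed_topologicalClosure _) hF

theorem exists_neuron_sum_approx {σ : ℝ → ℝ} (hσ : IsActivation σ) {φ : X → Q → ℝ}
    (hφc : Continuous φ) (hφ : Function.Injective φ) {f : X → ℝ} (hf : Continuous f)
    {ε : ℝ} (hε : 0 < ε) :
    ∃ (n : ℕ) (c : Fin n → ℝ) (v : Fin n → Option Q → ℝ),
      ∀ x, |f x - ∑ j, c j * neuron σ (v j) (φ x)| < ε := by
  have hmem : (⟨f, hf⟩ : C(X, ℝ)) ∈
      (Submodule.span ℝ (Set.range (neuronMap hσ.continuous ⟨φ, hφc⟩))).topologicalClosure := by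
    rw [closure_span_neuronMap_eq_top hσ _ hφ]; trivial
  rw [← SetLike.mem_coe, Submodule.topologicalClosure_coe, Metric.mem_closure_iff] at hmem
  obtain ⟨F, hF, hd⟩ := hmem ε hε
  obtain ⟨n, c, g, rfl⟩ := Submodule.mem_span_set'.1 hF
  choose v hv using fun j => (g j).2
  refine ⟨n, c, v, fun x => ?_⟩
  have := (ContinuousMap.dist_apply_le_dist x).trans_lt hd
  rw [Real.dist_eq] at this
  simpa [← hv, neuronMap] using this

end Density

/-! ### The reservoir recursion and its inversion. -/

section Recursion

variable {T d : ℕ}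

/-- The part of the randomised signature in `ℝ^{Td}`, as a function of a stream indexed by `ℕ`. -/
def blockState (σ : ℝ → ℝ) (U : Matrix (Block (T - 1) d) (Block (T - 1) d) ℝ) (a : Fin d → ℝ)
    (x : ℕ → Fin d → ℝ) : ℕ → Block T d → ℝ
  | 0 => 0
  | t + 1 => fun p => blockState σ U a x t p + σ ((shiftMatrix U *ᵥ blockState σ U a x t) p) +
      if p.1.val = 0 then σ (a p.2) * x t p.2 else 0

/-- Extension of a finite stream by zero. -/
def extend {n : ℕ} (x : Fin n → EuclideanSpace ℝ (Fin d)) (t : ℕ) (i : Fin d) : ℝ :=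
  if h : t < n then x ⟨t, h⟩ i else 0

theorem shiftMatrix_apply_of_lt {U : Matrix (Block (T - 1) d) (Block (T - 1) d) ℝ}
    (hU : ∀ p q, toLex q < toLex p → U p q = 0) {p q : Block T d} (h : q.1.val + 1 < p.1.val) :
    shiftMatrix U p q = 0 := by
  simp only [shiftMatrix, Matrix.of_apply]
  split_ifs with h'
  · refine hU _ _ (Prod.Lex.toLex_lt_toLex.2 (Or.inl ?_))
    simp only [Fin.lt_def]; omega
  · rfl

theorem shiftMatrix_succ_apply (U : Matrix (Block (T - 1) d) (Block (T - 1) d) ℝ) {p : Block T d}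
    (hp : p.1.val < T - 1) (q : Block T d) :
    shiftMatrix U (⟨p.1.val + 1, by omega⟩, p.2) q =
      if hq : q.1.val < T - 1 then U (⟨p.1.val, hp⟩, p.2) (⟨q.1.val, hq⟩, q.2) else 0 := by
  simp [shiftMatrix]

/-- Finite propagation speed: the input enters block `0`, and block `k + 1` reads only blocks from
`k` on. Block `k` is thus still at rest at time `k`. -/
theorem blockState_eq_zero {σ : ℝ → ℝ} (hσ : σ 0 = 0)
    {U : Matrix (Block (T - 1) d) (Block (T - 1) d) ℝ}
    (hU : ∀ p q, toLex q < toLex p → U p q = 0) (a : Fin d → ℝ) (x : ℕ → Fin d → ℝ) (t : ℕ)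
    (p : Block T d) (hp : t ≤ p.1.val) : blockState σ U a x t p = 0 := by
  induction t generalizing p with
  | zero => rfl
  | succ t ih =>
    have : (shiftMatrix U *ᵥ blockState σ U a x t) p = 0 := by
      simp only [Matrix.mulVec, dotProduct]
      refine Finset.sum_eq_zero fun q _ => ?_
      rcases lt_or_ge q.1.val t with h | h
      · rw [shiftMatrix_apply_of_lt hU (by omega), zero_mul]
      · rw [ih q h, mul_zero]
    simp only [blockState]
    rw [this, hσ, ih p (by omega), if_neg (by omega), add_zero, add_zero]

/-- A state with known last block is determined by its image under one step of the recursion. -/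
theorem eq_of_shift_step_eq {σ : ℝ → ℝ} (hσ : Function.Injective σ)
    {U : Matrix (Block (T - 1) d) (Block (T - 1) d) ℝ}
    (hU : ∀ p q, toLex q < toLex p → U p q = 0) (hdiag : ∀ p, U p p ≠ 0) {r r' : Block T d → ℝ}
    (hlast : ∀ p, T - 1 ≤ p.1.val → r p = r' p)
    (hstep : ∀ p, p.1.val ≠ 0 →
      r p + σ ((shiftMatrix U *ᵥ r) p) = r' p + σ ((shiftMatrix U *ᵥ r') p)) : r = r' := by
  have key : ∀ l : Fin T ×ₗ Fin d, r (ofLex l) = r' (ofLex l) := by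
    intro l
    -- Back substitution from the last coordinate down. Row `p'`, one block after `p`, of the
    -- shifted matrix is row `p` of `U`: earlier entries vanish by triangularity, later ones meet
    -- coordinates known to agree, and only `U p p * (r p - r' p)` remains.
    induction l using WellFoundedGT.induction with
    | ind l ih =>
    obtain ⟨p, rfl⟩ := toLex.surjective l
    rw [ofLex_toLex]
    rcases le_or_gt (T - 1) p.1.val with h | h
    · exact hlast p h
    let p' : Block T d := (⟨p.1.val + 1, by omega⟩, p.2)
    have hlt : toLex p < toLex p' :=
      Prod.Lex.toLex_lt_toLex.2 (Or.inl (by simp only [p', Fin.lt_def]; omega))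
    have h1 : r p' = r' p' := ih _ hlt
    have h2 := hstep p' (by simp [p'])
    rw [h1] at h2
    have h3 : (shiftMatrix U *ᵥ (r - r')) p' = 0 := by
      rw [Matrix.mulVec_sub, Pi.sub_apply, hσ (add_left_cancel h2), sub_self]
    have h4 : (shiftMatrix U *ᵥ (r - r')) p' = shiftMatrix U p' p * (r p - r' p) := by
      simp only [Matrix.mulVec, dotProduct]
      refine Finset.sum_eq_single p (fun q _ hq => ?_) (by simp)
      rcases lt_or_gt_of_ne (toLex.injective.ne hq) with hqp | hqp
      · have : shiftMatrix U p' q = 0 := by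
          rw [shiftMatrix_succ_apply U h]
          split_ifs with hq'
          · refine hU _ _ (Prod.Lex.toLex_lt_toLex.2 ?_)
            rcases Prod.Lex.toLex_lt_toLex.1 hqp with h5 | ⟨h5, h6⟩
            · exact Or.inl h5
            · exact Or.inr ⟨by simp [h5], h6⟩
          · rfl
        rw [this, zero_mul]
      · rw [Pi.sub_apply, show r q = r' q from ih _ hqp, sub_self, mul_zero]
    rw [h3, shiftMatrix_succ_apply U h, dif_pos h] at h4
    exact sub_eq_zero.1 ((mul_eq_zero.1 h4.symm).resolve_left (hdiag _))
  exact funext fun p => key (toLex p)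

/-- Decoding runs backwards in time. The last block is still zero at time `t ≤ T - 1`, so the state
at `t + 1` determines the one at `t`. The first block then reveals the input, because each `σ (a i)`
is nonzero. -/
theorem blockState_injective {σ : ℝ → ℝ} (hσ : IsActivation σ)
    {U : Matrix (Block (T - 1) d) (Block (T - 1) d) ℝ}
    (hU : ∀ p q, toLex q < toLex p → U p q = 0) (hdiag : ∀ p, U p p ≠ 0) {a : Fin d → ℝ}
    (ha : ∀ i, a i ≠ 0) (x y : ℕ → Fin d → ℝ) (t : ℕ) (ht : t ≤ T)
    (h : blockState (T := T) σ U a x t = blockState σ U a y t) (s : ℕ) (hs : s < t) :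
    x s = y s := by
  induction t generalizing s with
  | zero => omega
  | succ t ih =>
    have hr : blockState (T := T) σ U a x t = blockState σ U a y t := by
      refine eq_of_shift_step_eq hσ.injective hU hdiag (fun p hp => ?_) (fun p hp => ?_)
      · rw [blockState_eq_zero hσ.map_zero hU a x t p (by omega),
          blockState_eq_zero hσ.map_zero hU a y t p (by omega)]
      · simpa [blockState, hp] using congrFun h p
    rcases Nat.lt_succ_iff_lt_or_eq.1 hs with h' | rfl
    · exact ih (by omega) hr s h'
    · funext i
      have h0 := congrFun h (⟨0, by omega⟩, i)
      have hai : σ (a i) ≠ 0 := fun h1 => ha i (hσ.injective (h1.trans hσ.map_zero.symm))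
      simpa [blockState, hr, hai] using h0

theorem blockState_congr (σ : ℝ → ℝ) (U : Matrix (Block (T - 1) d) (Block (T - 1) d) ℝ)
    (a : Fin d → ℝ) {x y : ℕ → Fin d → ℝ} (t : ℕ) (h : ∀ s < t, x s = y s) :
    blockState (T := T) σ U a x t = blockState σ U a y t := by
  induction t with
  | zero => rfl
  | succ t ih =>
    funext p
    rw [blockState, blockState, ih fun s hs => h s (by omega), h t (by omega)]

theorem continuous_shiftMatrix :
    Continuous (shiftMatrix : Matrix (Block (T - 1) d) (Block (T - 1) d) ℝ → _) := by
  refine continuous_matrix fun p q => ?_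
  simp only [shiftMatrix, Matrix.of_apply]
  split_ifs <;> fun_prop

theorem continuous_blockState {Z : Type*} [TopologicalSpace Z] {σ : ℝ → ℝ} (hσ : Continuous σ)
    {U : Z → Matrix (Block (T - 1) d) (Block (T - 1) d) ℝ} (hU : Continuous U)
    {a : Z → Fin d → ℝ} (ha : Continuous a) {x : Z → ℕ → Fin d → ℝ}
    (hx : ∀ s i, Continuous fun z => x z s i) (t : ℕ) :
    Continuous fun z => blockState (T := T) σ (U z) (a z) (x z) t := by
  induction t with
  | zero => exact continuous_const
  | succ t ih =>
    refine continuous_pi fun p => ?_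
    have h1 : Continuous fun z =>
        (shiftMatrix (U z) *ᵥ blockState (T := T) σ (U z) (a z) (x z) t) p :=
      (continuous_apply p).comp ((continuous_shiftMatrix.comp hU).matrix_mulVec ih)
    have h2 := hx t p.2
    have h3 : Continuous fun z => a z p.2 := (continuous_apply _).comp ha
    have h4 : Continuous fun z => blockState (T := T) σ (U z) (a z) (x z) t p :=
      (continuous_apply p).comp ih
    simp only [blockState]
    refine (h4.add (hσ.comp h1)).add ?_
    split_ifs
    · exact (hσ.comp h3).mul h2
    · exact continuous_const

theorem continuous_extend {n : ℕ} (s : ℕ) (i : Fin d) :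
    Continuous fun x : Fin n → EuclideanSpace ℝ (Fin d) => extend x s i := by
  unfold extend
  split_ifs <;> fun_prop

variable {M : ℕ}

/-- As `A₂ = 0` and `σ 0 = 0`, the input acts only where the bias `ξ₂` is nonzero, that is, in the
first block. -/
theorem RS_succ (σ : ℝ → ℝ) (hσ : σ 0 = 0) (A : Matrix (Fin M) (Block T d) ℝ)
    (U : Matrix (Block (T - 1) d) (Block (T - 1) d) ℝ) (ξ : Fin M → ℝ) (a : Fin d → ℝ)
    (x : Fin T → EuclideanSpace ℝ (Fin d)) (t : Fin T) (r : State M T d → ℝ)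
    (hr : RS σ (schemeA₁ A U) (schemeξ₁ T d ξ) (schemeA₂ M T d) (schemeξ₂ M T a) x t.castSucc = r) :
    RS σ (schemeA₁ A U) (schemeξ₁ T d ξ) (schemeA₂ M T d) (schemeξ₂ M T a) x t.succ =
      Sum.elim (fun j => r (Sum.inl j) + σ ((A *ᵥ fun p => r (Sum.inr p)) j + ξ j))
        (fun p => r (Sum.inr p) + σ ((shiftMatrix U *ᵥ fun p => r (Sum.inr p)) p) +
          if p.1.val = 0 then σ (a p.2) * x t p.2 else 0) := by
  have h : RS σ (schemeA₁ A U) (schemeξ₁ T d ξ) (schemeA₂ M T d) (schemeξ₂ M T a) x t.succ =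
      r + (fun k => σ ((schemeA₁ A U *ᵥ r + schemeξ₁ T d ξ) k)) +
        ∑ i : Fin d, x t i • (fun k => σ ((schemeA₂ M T d i *ᵥ r + schemeξ₂ M T a i) k)) := by
    simp only [← hr, RS, Fin.induction_succ]
  have hmul : schemeA₁ A U *ᵥ r = Sum.elim (A *ᵥ fun p => r (Sum.inr p))
      (shiftMatrix U *ᵥ fun p => r (Sum.inr p)) := by
    rw [schemeA₁, Matrix.fromBlocks_mulVec]
    simp [Function.comp_def]
  rw [h, hmul]
  funext k
  rcases k with j | p
  · simp [schemeξ₁, schemeξ₂, schemeA₂, hσ, Finset.sum_apply]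
  · simp only [schemeξ₁, schemeξ₂, schemeA₂, Finset.sum_apply, Pi.add_apply, Sum.elim_inr,
      Pi.zero_apply, add_zero, Matrix.zero_mulVec, zero_add, Pi.smul_apply, smul_eq_mul]
    congr 1
    split_ifs with hp
    · rw [Finset.sum_eq_single p.2]
      · simp [hp, mul_comm]
      · intro i _ hi
        simp [hi.symm, hσ]
      · simp
    · simp [hp, hσ]

theorem RS_inr_eq_blockState (σ : ℝ → ℝ) (hσ : σ 0 = 0) (A : Matrix (Fin M) (Block T d) ℝ)
    (U : Matrix (Block (T - 1) d) (Block (T - 1) d) ℝ) (ξ : Fin M → ℝ) (a : Fin d → ℝ)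
    (x : Fin T → EuclideanSpace ℝ (Fin d)) (t : Fin (T + 1)) :
    (fun p => RS σ (schemeA₁ A U) (schemeξ₁ T d ξ) (schemeA₂ M T d) (schemeξ₂ M T a) x t
      (Sum.inr p)) = blockState σ U a (extend x) t := by
  induction t using Fin.induction with
  | zero => rfl
  | succ t ih =>
    rw [Fin.val_succ, blockState]
    simp only [RS_succ σ hσ A U ξ a x t _ rfl]
    simp only [Sum.elim_inr, ih, Fin.val_castSucc]
    funext p
    simp [congrFun ih p, extend]

/-- The first `M` coordinates of the terminal increment are random neurons applied to the block
state, which depends on `x_1, …, x_{T-1}` only. -/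
theorem deltaRS_last_inl (hT : 1 ≤ T) (σ : ℝ → ℝ) (hσ : σ 0 = 0) (A : Matrix (Fin M) (Block T d) ℝ)
    (U : Matrix (Block (T - 1) d) (Block (T - 1) d) ℝ) (ξ : Fin M → ℝ) (a : Fin d → ℝ)
    (x : Fin T → EuclideanSpace ℝ (Fin d)) (j : Fin M) :
    deltaRS σ (schemeA₁ A U) (schemeξ₁ T d ξ) (schemeA₂ M T d) (schemeξ₂ M T a) x
        ⟨T - 1, Nat.sub_lt hT Nat.one_pos⟩ (Sum.inl j) =
      neuron σ (fun o => o.elim (ξ j) (A j)) (blockState σ U a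
        (extend fun s : Fin (T - 1) => x (Fin.castLE (Nat.sub_le T 1) s)) (T - 1)) := by
  rw [deltaRS, Pi.sub_apply, RS_succ σ hσ A U ξ a x _ _ rfl]
  simp only [Sum.elim_inl, add_sub_cancel_left, RS_inr_eq_blockState σ hσ]
  rw [neuron]
  have : blockState (T := T) σ U a (extend x) (T - 1) = blockState σ U a
      (extend fun s : Fin (T - 1) => x (Fin.castLE (Nat.sub_le T 1) s)) (T - 1) := by
    refine blockState_congr σ U a _ fun s hs => ?_
    funext i
    simp [extend, hs, show s < T by omega, Fin.castLE]
  simp only [Fin.castSucc_mk, this]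
  rfl

end Recursion

/-! ### Stability of the approximation and finite covers. -/

section Cover

variable {X Q Θ : Type*} [TopologicalSpace X] [CompactSpace X] [Fintype Q] [TopologicalSpace Θ]

theorem continuous_neuron {σ : ℝ → ℝ} (hσ : Continuous σ) :
    Continuous fun z : (Option Q → ℝ) × (Q → ℝ) => neuron σ z.1 z.2 := by
  unfold neuron; fun_prop

/-- Approximation by networks is stable under small perturbations of the feature map and of the
weights, with fixed readout coefficients. -/
theorem exists_open_neuron_sum_approx {σ : ℝ → ℝ} (hσ : IsActivation σ) {Φ : Θ → X → Q → ℝ}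
    (hΦ : Continuous fun z : Θ × X => Φ z.1 z.2) {f : X → ℝ} (hf : Continuous f) {ε : ℝ}
    (hε : 0 < ε) {θ₀ : Θ} (hinj : Function.Injective (Φ θ₀)) :
    ∃ O : Set Θ, IsOpen O ∧ θ₀ ∈ O ∧ ∃ (n : ℕ) (c : Fin n → ℝ) (V : Fin n → Set (Option Q → ℝ)),
      (∀ j, IsOpen (V j) ∧ (V j).Nonempty) ∧ ∀ θ ∈ O, ∀ v : Fin n → Option Q → ℝ,
        (∀ j, v j ∈ V j) → ∀ x, |f x - ∑ j, c j * neuron σ (v j) (Φ θ x)| < ε := by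
  obtain ⟨n, c, v₀, h₀⟩ := exists_neuron_sum_approx hσ
    (φ := Φ θ₀) (hΦ.comp (Continuous.prodMk_right θ₀)) hinj hf hε
  have hcont : Continuous fun z : (Θ × (Fin n → Option Q → ℝ)) × X =>
      |f z.2 - ∑ j, c j * neuron σ (z.1.2 j) (Φ z.1.1 z.2)| := by
    refine ((hf.comp continuous_snd).sub (continuous_finsetSum _ fun j _ => ?_)).abs
    refine continuous_const.mul ((continuous_neuron hσ.continuous).comp (Continuous.prodMk ?_ ?_))
    · fun_prop
    · exact hΦ.comp (by fun_prop : Continuous fun z : (Θ × (Fin n → Option Q → ℝ)) × X =>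
        (z.1.1, z.2))
  -- Tube lemma: compactness of `X` makes the neighbourhood of `(θ₀, v₀)` uniform in `x`.
  have hev : ∀ᶠ z : Θ × (Fin n → Option Q → ℝ) in 𝓝 (θ₀, v₀), ∀ x ∈ (Set.univ : Set X),
      |f x - ∑ j, c j * neuron σ (z.2 j) (Φ z.1 x)| < ε :=
    isCompact_univ.eventually_forall_of_forall_eventually fun x _ =>
      hcont.continuousAt.eventually_lt_const (h₀ x)
  rw [nhds_prod_eq] at hev
  obtain ⟨p, hp, q, hq, hpq⟩ := eventually_prod_iff.1 hev
  obtain ⟨O, hOp, hO, hθ⟩ := eventually_nhds_iff.1 hp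
  rw [nhds_pi, Filter.Eventually, Filter.mem_pi'] at hq
  obtain ⟨I, t, ht, htq⟩ := hq
  choose V hVt hV hvV using fun j => mem_nhds_iff.1 (ht j)
  refine ⟨O, hO, hθ, n, c, V, fun j => ⟨hV j, v₀ j, hvV j⟩, fun θ hθO v hv x => ?_⟩
  exact hpq (hOp θ hθO) (htq fun j _ => hVt j (hv j)) x trivial

/-- Over a compact set of feature maps, a readout exists as soon as the rows of the weight matrix
visit finitely many prescribed open sets. -/
theorem exists_finite_open_cover_readout {σ : ℝ → ℝ} (hσ : IsActivation σ) {Φ : Θ → X → Q → ℝ}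
    (hΦ : Continuous fun z : Θ × X => Φ z.1 z.2) {f : X → ℝ} (hf : Continuous f) {ε : ℝ}
    (hε : 0 < ε) {C : Set Θ} (hC : IsCompact C) (hinj : ∀ θ ∈ C, Function.Injective (Φ θ)) :
    ∃ (O : Set Θ) (𝒱 : Set (Set (Option Q → ℝ))), IsOpen O ∧ C ⊆ O ∧ 𝒱.Finite ∧
      (∀ V ∈ 𝒱, IsOpen V ∧ V.Nonempty) ∧
      ∀ θ ∈ O, ∀ (M : ℕ) (v : Fin M → Option Q → ℝ), (∀ V ∈ 𝒱, ∃ m, v m ∈ V) →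
        ∃ w : Fin M → ℝ, ∀ x, |f x - ∑ m, w m * neuron σ (v m) (Φ θ x)| < ε := by
  refine hC.induction_on (p := fun C => ∃ (O : Set Θ) (𝒱 : Set (Set (Option Q → ℝ))), IsOpen O ∧
      C ⊆ O ∧ 𝒱.Finite ∧ (∀ V ∈ 𝒱, IsOpen V ∧ V.Nonempty) ∧
      ∀ θ ∈ O, ∀ (M : ℕ) (v : Fin M → Option Q → ℝ), (∀ V ∈ 𝒱, ∃ m, v m ∈ V) →
        ∃ w : Fin M → ℝ, ∀ x, |f x - ∑ m, w m * neuron σ (v m) (Φ θ x)| < ε) ?_ ?_ ?_ ?_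
  · exact ⟨∅, ∅, isOpen_empty, subset_rfl, Set.finite_empty, by simp, by simp⟩
  · rintro s t hst ⟨O, 𝒱, hO, htO, h⟩
    exact ⟨O, 𝒱, hO, hst.trans htO, h⟩
  · rintro s t ⟨O, 𝒱, hO, hsO, hfin, hV, h⟩ ⟨O', 𝒱', hO', htO', hfin', hV', h'⟩
    refine ⟨O ∪ O', 𝒱 ∪ 𝒱', hO.union hO', Set.union_subset_union hsO htO', hfin.union hfin', ?_, ?_⟩
    · rintro V (hVm | hVm)
      exacts [hV V hVm, hV' V hVm]
    · rintro θ (hθ | hθ) M v hv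
      exacts [h θ hθ M v fun V hVm => hv V (Or.inl hVm),
        h' θ hθ M v fun V hVm => hv V (Or.inr hVm)]
  · intro θ₀ hθ₀
    obtain ⟨O, hO, hθO, n, c, V, hV, h⟩ :=
      exists_open_neuron_sum_approx hσ hΦ hf hε (hinj θ₀ hθ₀)
    refine ⟨O, mem_nhdsWithin_of_mem_nhds (hO.mem_nhds hθO), O, Set.range V, hO, subset_rfl,
      Set.finite_range V, by rintro _ ⟨j, rfl⟩; exact hV j, fun θ hθ M v hv => ?_⟩
    choose m hm using fun j => hv (V j) ⟨j, rfl⟩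
    -- Several neurons may be served by the same row, whose readout coefficient is then the sum of
    -- theirs; unused rows get `0`.
    refine ⟨fun i => ∑ j with m j = i, c j, fun x => ?_⟩
    have hsum : ∑ i, (∑ j with m j = i, c j) * neuron σ (v i) (Φ θ x) =
        ∑ j, c j * neuron σ (v (m j)) (Φ θ x) := by
      rw [← Finset.sum_fiberwise Finset.univ m]
      refine Finset.sum_congr rfl fun i _ => ?_
      rw [Finset.sum_mul]
      exact Finset.sum_congr rfl fun j hj => by rw [(Finset.mem_filter.1 hj).2]
    rw [hsum]
    exact h θ hθ (fun j => v (m j)) hm x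

end Cover

/-! ### Independent rows. -/

section Probability

variable {Ω : Type*} [MeasurableSpace Ω] {P : Measure Ω}

/-- The probability that none of the rows of an i.i.d. random matrix lies in a given set. -/
theorem measure_forall_row_notMem {κ Q : Type*} [Fintype κ] [Fintype Q] {μ : Measure ℝ}
    [IsProbabilityMeasure μ] {Z : κ × Q → Ω → ℝ} (hm : ∀ k, Measurable (Z k))
    (hlaw : ∀ k, P.map (Z k) = μ) (hind : iIndepFun Z P) {V : Set (Q → ℝ)}
    (hV : MeasurableSet V) :
    P {ω | ∀ i, (fun q => Z (i, q) ω) ∉ V} =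
      (1 - Measure.pi (fun _ : Q => μ) V) ^ Fintype.card κ := by
  have h1 : P.map (fun ω k => Z k ω) = Measure.infinitePi fun _ => μ := by
    rw [hind.map_fun_eq_infinitePi_map hm]
    simp only [hlaw]
  -- Currying the product law shows that the rows are themselves independent, each with the product
  -- law.
  have h2 : P.map (fun ω i q => Z (i, q) ω) =
      Measure.pi fun _ : κ => Measure.pi fun _ : Q => μ := by
    have := Measure.infinitePi_map_curry (fun (_ : κ) (_ : Q) => μ)
    rw [← h1, Measure.map_map (by fun_prop) (measurable_pi_iff.2 hm)] at this
    simp only [Measure.infinitePi_eq_pi] at this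
    exact this
  have h3 : {ω | ∀ i, (fun q => Z (i, q) ω) ∉ V} =
      (fun ω i q => Z (i, q) ω) ⁻¹' (Set.univ.pi fun _ => Vᶜ) := by
    ext ω; simp [Set.mem_pi]
  rw [h3, ← Measure.map_apply (by fun_prop) (MeasurableSet.univ_pi fun _ => hV.compl), h2,
    Measure.pi_pi]
  simp [prob_compl_eq_one_sub hV]

end Probability

/-! ### The reservoir parameters. -/

section Parameters

variable {T d : ℕ}

/-- The labels of the random entries of `U` and of `a₁, …, a_d`. -/
abbrev ParamIndex (T d : ℕ) : Type :=
  {pq : Block (T - 1) d × Block (T - 1) d // toLex pq.1 ≤ toLex pq.2} ⊕ Fin d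

/-- The upper triangular matrix with given entries on and above the diagonal. -/
def paramU (θ : ParamIndex T d → ℝ) : Matrix (Block (T - 1) d) (Block (T - 1) d) ℝ :=
  Matrix.of fun p q => if h : toLex p ≤ toLex q then θ (Sum.inl ⟨(p, q), h⟩) else 0

theorem paramU_apply_of_lt (θ : ParamIndex T d → ℝ) (p q : Block (T - 1) d)
    (h : toLex q < toLex p) : paramU θ p q = 0 := by
  simp [paramU, not_le.2 h]

theorem paramU_diag (θ : ParamIndex T d → ℝ) (p : Block (T - 1) d) :
    paramU θ p p = θ (Sum.inl ⟨(p, p), le_rfl⟩) := by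
  simp [paramU]

theorem continuous_paramU : Continuous (paramU : (ParamIndex T d → ℝ) → _) := by
  refine continuous_matrix fun p q => ?_
  simp only [paramU, Matrix.of_apply]
  split_ifs <;> fun_prop

/-- An absolutely continuous law has no atom at `0`. Injectivity of the feature needs only the
diagonal of `U` and the `a_i` to be nonzero, but asking it of every parameter costs no probability.
-/
theorem measure_pi_forall_ne_zero {κ : Type*} [Fintype κ] {μ : Measure ℝ}
    [IsProbabilityMeasure μ] (hac : μ ≪ volume) :
    Measure.pi (fun _ : κ => μ) {θ | ∀ k, θ k ≠ 0} = 1 := by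
  have h0 : μ {0}ᶜ = 1 := by
    rw [prob_compl_eq_one_iff (measurableSet_singleton 0)]
    exact hac (measure_singleton 0)
  have : {θ : κ → ℝ | ∀ k, θ k ≠ 0} = Set.univ.pi fun _ => {0}ᶜ := by
    ext θ; simp [Set.mem_pi]
  rw [this, Measure.pi_pi]
  simp [h0]

/-- The block state at time `T - 1` as a function of the parameters and the stream. -/
def feature (σ : ℝ → ℝ) (θ : ParamIndex T d → ℝ)
    (x : Fin (T - 1) → EuclideanSpace ℝ (Fin d)) : Block T d → ℝ :=
  blockState σ (paramU θ) (fun i => θ (Sum.inr i)) (extend x) (T - 1)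

theorem continuous_feature {σ : ℝ → ℝ} (hσ : Continuous σ) :
    Continuous fun z : (ParamIndex T d → ℝ) × (Fin (T - 1) → EuclideanSpace ℝ (Fin d)) =>
      feature σ z.1 z.2 :=
  continuous_blockState hσ (continuous_paramU.comp continuous_fst) (by fun_prop)
    (fun s i => (continuous_extend s i).comp continuous_snd) _

theorem feature_injective {σ : ℝ → ℝ} (hσ : IsActivation σ) {θ : ParamIndex T d → ℝ}
    (hθ : ∀ k, θ k ≠ 0) : Function.Injective (feature σ θ) := by
  intro x y hxy
  have h := blockState_injective hσ (paramU_apply_of_lt θ)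
    (fun p => by rw [paramU_diag]; exact hθ _) (fun i => hθ _) _ _ _ (Nat.sub_le T 1) hxy
  funext s
  ext i
  simpa [extend] using congrFun (h s s.2) i

end Parameters

/-! ### Hitting probabilities and labels of the entries. -/

/-- Enough rows visit each of finitely many nonempty open sets with probability close to one. -/
theorem exists_sum_one_sub_pow_lt {E : Type*} [TopologicalSpace E] [MeasurableSpace E]
    (ν : Measure E) [IsProbabilityMeasure ν] [ν.IsOpenPosMeasure] (𝒱 : Finset (Set E))
    (h𝒱 : ∀ V ∈ 𝒱, IsOpen V ∧ V.Nonempty) {a b : ENNReal} (hab : a < b) :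
    ∃ M : ℕ, 1 ≤ M ∧ a + ∑ V ∈ 𝒱, (1 - ν V) ^ M < b := by
  have hlim : Tendsto (fun M : ℕ => a + ∑ V ∈ 𝒱, (1 - ν V) ^ M) atTop (𝓝 (a + ∑ V ∈ 𝒱, 0)) := by
    refine tendsto_const_nhds.add (tendsto_finsetSum _ fun V hV => ?_)
    refine ENNReal.tendsto_pow_atTop_nhds_zero_of_lt_one
      (ENNReal.sub_lt_self ENNReal.one_ne_top one_ne_zero ?_)
    exact ((h𝒱 V hV).1.measure_pos ν (h𝒱 V hV).2).ne'
  rw [Finset.sum_const_zero, add_zero] at hlim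
  exact ((eventually_ge_atTop 1).and (hlim.eventually_lt_const hab)).exists

/-- The label of the entry of `A` or `ξ` in a given row. -/
def rowIndex (M T d : ℕ) (k : Fin M × Option (Block T d)) : EntryIndex M T d :=
  k.2.elim (Sum.inr (Sum.inr (Sum.inl k.1))) (fun p => Sum.inl (k.1, p))

theorem rowIndex_injective (M T d : ℕ) : Function.Injective (rowIndex M T d) := by
  rintro ⟨i, _ | p⟩ ⟨j, _ | q⟩ h <;> simp_all [rowIndex]

/-- The label of an entry of `U` or of `a` among all the entries. -/
def paramIndex (M T d : ℕ) : ParamIndex T d → EntryIndex M T d :=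
  Sum.elim (fun pq => Sum.inr (Sum.inl pq)) (fun i => Sum.inr (Sum.inr (Sum.inr i)))

theorem paramIndex_injective (M T d : ℕ) : Function.Injective (paramIndex M T d) := by
  rintro (p | i) (q | j) h <;> simp_all [paramIndex]

theorem IsSamplingScheme.paramU_eq {Ω : Type*} [MeasurableSpace Ω] {P : Measure Ω}
    {μ₁ : Measure ℝ} {M T d : ℕ} {A : Ω → Matrix (Fin M) (Block T d) ℝ}
    {U : Ω → Matrix (Block (T - 1) d) (Block (T - 1) d) ℝ} {ξ : Ω → Fin M → ℝ}
    {a : Ω → Fin d → ℝ} (h : IsSamplingScheme P μ₁ A U ξ a) (ω : Ω) :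
    paramU (fun k => entries A U ξ a (paramIndex M T d k) ω) = U ω := by
  ext p q
  simp only [paramU, Matrix.of_apply]
  split_ifs with hpq
  · rfl
  · exact (h.upper ω p q (not_le.1 hpq)).symm

end RandSig

/-! ### The approximation theorem. -/

theorem mainTheorem1 {d T : ℕ} (hd : 1 ≤ d) (hT : 1 ≤ T)
    (σ : ℝ → ℝ) (hσ : RandSig.IsActivation σ)
    (μ₁ : Measure ℝ) [IsProbabilityMeasure μ₁] (hac : μ₁ ≪ volume) [μ₁.IsOpenPosMeasure]
    (K : Set (EuclideanSpace ℝ (Fin d))) (hK : IsCompact K)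
    (f : (Fin (T - 1) → EuclideanSpace ℝ (Fin d)) → ℝ)
    (hf : ContinuousOn f (Set.univ.pi fun _ => K))
    (α : ℝ) (hα : α ∈ Set.Ioo (0 : ℝ) 1) (ε : ℝ) (hε : 0 < ε) :
    ∃ M : ℕ, 1 ≤ M ∧
      ∀ (Ω : Type*) [MeasurableSpace Ω] (P : Measure Ω) [IsProbabilityMeasure P]
        (A : Ω → Matrix (Fin M) (RandSig.Block T d) ℝ)
        (U : Ω → Matrix (RandSig.Block (T - 1) d) (RandSig.Block (T - 1) d) ℝ)
        (ξ : Ω → Fin M → ℝ) (a : Ω → Fin d → ℝ),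
        RandSig.IsSamplingScheme P μ₁ A U ξ a →
        -- an event of probability greater than `α` on which a readout exists
        ∃ E : Set Ω, MeasurableSet E ∧ ENNReal.ofReal α < P E ∧
          ∀ ω ∈ E, ∃ w : Fin M → ℝ,
            -- the supremum is over `x_1, …, x_{T-1} ∈ K` and arbitrary `x_T`
            (⨆ x : {x : Fin T → EuclideanSpace ℝ (Fin d) //
                ∀ s : Fin (T - 1), x (Fin.castLE (Nat.sub_le T 1) s) ∈ K},
              ENNReal.ofReal |f (fun s => x.1 (Fin.castLE (Nat.sub_le T 1) s)) -
                (Sum.elim w 0 : RandSig.State M T d → ℝ) ⬝ᵥ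
                  RandSig.deltaRS σ (RandSig.schemeA₁ (A ω) (U ω)) (RandSig.schemeξ₁ T d (ξ ω))
                    (RandSig.schemeA₂ M T d) (RandSig.schemeξ₂ M T (a ω)) x.1
                    ⟨T - 1, Nat.sub_lt hT Nat.one_pos⟩|)
              < ENNReal.ofReal ε := by
  classical
  set X : Set (Fin (T - 1) → EuclideanSpace ℝ (Fin d)) := Set.univ.pi fun _ => K with hX
  have : CompactSpace X := isCompact_iff_compactSpace.1 (isCompact_univ_pi fun _ => hK)
  -- a compact set of parameters with injective features and probability greater than `α`
  obtain ⟨C, hCG, hC, hαC⟩ : ∃ C ⊆ {θ : RandSig.ParamIndex T d → ℝ | ∀ k, θ k ≠ 0},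
      IsCompact C ∧ ENNReal.ofReal α < Measure.pi (fun _ => μ₁) C := by
    -- Inner regularity, applied to a set of full probability.
    refine MeasurableSet.exists_lt_isCompact_of_ne_top (IsOpen.measurableSet ?_)
      (measure_ne_top _ _) ?_
    · simp only [Set.ofPred_forall]
      exact isOpen_iInter_of_finite fun k => isOpen_ne_fun (continuous_apply k) continuous_const
    · rw [RandSig.measure_pi_forall_ne_zero hac, ENNReal.ofReal_lt_one]
      exact hα.2
  obtain ⟨O, 𝒱, hO, hCO, hfin, h𝒱, hread⟩ := RandSig.exists_finite_open_cover_readout hσ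
    (Φ := fun θ (x : X) => RandSig.feature σ θ x.1) (f := fun x => f x.1)
    ((RandSig.continuous_feature hσ.continuous).comp
      (continuous_fst.prodMk (continuous_subtype_val.comp continuous_snd)))
    (continuousOn_iff_continuous_domRestrict.1 hf) (half_pos hε) hC
    (fun θ hθ => (RandSig.feature_injective hσ (hCG hθ)).comp Subtype.val_injective)
  -- The gap between `α` and the probability of `C` absorbs the probability of missing some `V`; `M`
  -- is fixed before the probability space.
  obtain ⟨M, hM, hlt⟩ := RandSig.exists_sum_one_sub_pow_lt
    (Measure.pi fun _ : Option (RandSig.Block T d) => μ₁) hfin.toFinset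
    (fun V hV => h𝒱 V (hfin.mem_toFinset.1 hV)) hαC
  refine ⟨M, hM, fun Ω _ P _ A U ξ a h => ?_⟩
  let θ : Ω → RandSig.ParamIndex T d → ℝ := fun ω k =>
    RandSig.entries A U ξ a (RandSig.paramIndex M T d k) ω
  let v : Fin M → Ω → Option (RandSig.Block T d) → ℝ := fun m ω o =>
    RandSig.entries A U ξ a (RandSig.rowIndex M T d (m, o)) ω
  have hθm : Measurable θ := measurable_pi_iff.2 fun k => h.measurable _
  have hvm : ∀ m, Measurable (v m) := fun m => measurable_pi_iff.2 fun o => h.measurable _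
  have hθlaw : P.map θ = Measure.pi fun _ => μ₁ := by
    have := (iIndepFun_iff_map_fun_eq_pi_map (fun k => (h.measurable _).aemeasurable)).1
      (h.indep.precomp (RandSig.paramIndex_injective M T d))
    simpa only [h.law] using this
  -- The good event: the parameters lie in the open set `O ⊇ C` and every prescribed open set is
  -- visited by some row.
  refine ⟨θ ⁻¹' O ∩ ⋂ V ∈ 𝒱, ⋃ m, v m ⁻¹' V, ?_, ?_, ?_⟩
  · refine (hθm hO.measurableSet).inter (MeasurableSet.biInter hfin.countable fun V hV => ?_)
    exact MeasurableSet.iUnion fun m => hvm m (h𝒱 V hV).1.measurableSet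
  · have hcover : θ ⁻¹' O ⊆ (θ ⁻¹' O ∩ ⋂ V ∈ 𝒱, ⋃ m, v m ⁻¹' V) ∪
        ⋃ V ∈ hfin.toFinset, {ω | ∀ m, v m ω ∉ V} := by
      intro ω hω
      by_cases hall : ∀ V ∈ 𝒱, ∃ m, v m ω ∈ V
      · exact Or.inl ⟨hω, by simpa using hall⟩
      · right
        push Not at hall
        simpa using hall
    have hmiss : ∀ V ∈ hfin.toFinset, P {ω | ∀ m, v m ω ∉ V} =
        (1 - Measure.pi (fun _ : Option (RandSig.Block T d) => μ₁) V) ^ M := by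
      intro V hV
      have := RandSig.measure_forall_row_notMem (fun k => h.measurable _) (fun k => h.law _)
        (h.indep.precomp (RandSig.rowIndex_injective M T d))
        (h𝒱 V (hfin.mem_toFinset.1 hV)).1.measurableSet
      rwa [Fintype.card_fin] at this
    have hle : Measure.pi (fun _ => μ₁) C ≤ P (θ ⁻¹' O ∩ ⋂ V ∈ 𝒱, ⋃ m, v m ⁻¹' V) +
        ∑ V ∈ hfin.toFinset,
          (1 - Measure.pi (fun _ : Option (RandSig.Block T d) => μ₁) V) ^ M := by
      calc Measure.pi (fun _ => μ₁) C ≤ P (θ ⁻¹' O) := by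
            rw [← hθlaw, ← Measure.map_apply hθm hO.measurableSet]
            exact measure_mono hCO
        _ ≤ _ := (measure_mono hcover).trans (measure_union_le _ _)
        _ ≤ _ := by
            gcongr
            refine (measure_biUnion_finset_le _ _).trans (Finset.sum_le_sum fun V hV => ?_)
            exact (hmiss V hV).le
    exact lt_of_add_lt_add_right (hlt.trans_le hle)
  · rintro ω ⟨hω, hrows⟩
    obtain ⟨w, hw⟩ := hread (θ ω) hω M (fun m => v m ω) (by simpa using hrows)
    -- A pointwise strict bound gives only a weak bound on the supremum, hence the accuracy `ε / 2`.
    refine ⟨w, lt_of_le_of_lt (iSup_le fun x => ENNReal.ofReal_le_ofReal (?_ : _ ≤ ε / 2))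
      ((ENNReal.ofReal_lt_ofReal_iff hε).2 (half_lt_self hε))⟩
    have hx := hw ⟨fun s => x.1 (Fin.castLE (Nat.sub_le T 1) s), fun s _ => x.2 s⟩
    have hv : ∀ m, v m ω = fun o => o.elim (ξ ω m) (A ω m) := by
      intro m
      funext o
      cases o <;> rfl
    simp only [RandSig.feature, hv] at hx
    rw [show RandSig.paramU (θ ω) = U ω from h.paramU_eq ω] at hx
    simp only [dotProduct, Fintype.sum_sum_type, Sum.elim_inl, Sum.elim_inr, Pi.zero_apply,
      zero_mul, Finset.sum_const_zero, add_zero, RandSig.deltaRS_last_inl hT σ hσ.map_zero]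
    exact hx.le
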